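/- Let $r\in\{1,2,\ldots\}\cup\{\infty\}$ and let $M$ be a finite-dimensional Hausdorff $C^r$-manifold without boundary (modelled on a fixed finite-dimensional real vector space; $M$ need not be connected, paracompact or second countable). Then there is a set $I$ such that $M$ admits a $C^r$-embedding, in the sense of Michal–Bastiani calculus, into the locally convex space $\mathbb{R}^I$ with the product topology. In fact, if $I=C^r_c(M,\mathbb{R})$ is the set of compactly supported $C^r$-functions $M\to\mathbb{R}$, then the evaluation map $M\to\mathbb{R}^I$, $x\mapsto (f(x))_{f\in I}$, is a $C^r$-embedding. Here the following terms are used. A map $f:U\to F$ on an open subset $U$ of a locally convex space $E$, with values in a locally convex space $F$, is $C^0$ if it is continuous; it is $C^{k+1}$ if it is continuous, all directional derivatives $df(x,v)=\lim_{t\to 0}t^{-1}(f(x+tv)-f(x))$ ($x\in U$, $v\in E$) exist, and $df:U\times E\to F$ is $C^k$; it is $C^\infty$ if it is $C^k$ for all $k$. A subset $N$ of a locally convex space $Y$ is a $C^r$-submanifold modelled on a closed vector subspace $F\subseteq Y$ if for every $p\in N$ there is a $C^r$-diffeomorphism $\varphi:U\to V$ between open subsets of $Y$ with $p\in U$ and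 $\varphi(U\cap N)=V\cap F$; the restrictions $U\cap N\to V\cap F$ of these $\varphi$ are the charts of $N$. A $C^r$-map $f:M\to Y$ is a $C^r$-embedding if $f(M)$ is a $C^r$-submanifold of $Y$, modelled on some closed vector subspace of $Y$, and $f:M\to f(M)$ is a $C^r$-diffeomorphism. -/

import Mathlib

open scoped Manifold ContDiff Topology

universe u v w

/-! ### Michal–Bastiani differential calculus

The calculus is meant for maps between Hausdorff real locally convex spaces. Only the vector space
structure and the topology enter the definitions. -/

/-- `MBContDiffOnNat k f U`, for an open set `U` of a locally convex space `E` and a map `f` with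
values in a locally convex space `F`: the map `f` is `C^k` on `U` in the sense of Michal–Bastiani.
`C^0` means continuous on `U`, and `f` is `C^(k+1)` if it is continuous on `U`, all directional
derivatives `df (x, v) = lim_{t → 0} t⁻¹ (f (x + t v) - f x)` with `x ∈ U` and `v ∈ E` exist, and
the map `df : U × E → F` is `C^k`. -/
def MBContDiffOnNat {F : Type v} [AddCommGroup F] [Module ℝ F] [TopologicalSpace F] :
    ℕ → ∀ {E : Type u} [AddCommGroup E] [Module ℝ E] [TopologicalSpace E],
      (E → F) → Set E → Prop
  | 0, _, _, _, _, f, U => ContinuousOn f U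
  | k + 1, E, _, _, _, f, U =>
      ContinuousOn f U ∧ ∃ df : E × E → F,
        (∀ x ∈ U, ∀ y : E,
          Filter.Tendsto (fun t : ℝ => t⁻¹ • (f (x + t • y) - f x)) (𝓝[≠] 0) (𝓝 (df (x, y)))) ∧
        MBContDiffOnNat k df (U ×ˢ (Set.univ : Set E))

/-- `f` is `C^r` on the open set `U` in the sense of Michal–Bastiani, where `r ∈ {0, 1, …, ∞}`. -/
def MBContDiffOn {E : Type u} [AddCommGroup E] [Module ℝ E] [TopologicalSpace E]
    {F : Type v} [AddCommGroup F] [Module ℝ F] [TopologicalSpace F]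
    (r : ℕ∞) (f : E → F) (U : Set E) : Prop :=
  ∀ k : ℕ, (k : ℕ∞) ≤ r → MBContDiffOnNat k f U

/-- A map `f : M → N` between manifolds modelled on locally convex spaces `E` and `F` is `C^r` in
the sense of Michal–Bastiani: it is continuous, and around every point there are charts of `M`
and `N` in which it is `C^r`. -/
def MBContMDiff (E : Type u) [AddCommGroup E] [Module ℝ E] [TopologicalSpace E]
    (F : Type v) [AddCommGroup F] [Module ℝ F] [TopologicalSpace F]
    {M : Type*} [TopologicalSpace M] [ChartedSpace E M]
    {N : Type*} [TopologicalSpace N] [ChartedSpace F N] (r : ℕ∞) (f : M → N) : Prop :=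
  Continuous f ∧ ∀ p : M, ∃ e ∈ atlas E M, ∃ e' ∈ atlas F N,
    p ∈ e.source ∧ f p ∈ e'.source ∧
      MBContDiffOn r (e' ∘ f ∘ e.symm) (e.target ∩ e.symm ⁻¹' (f ⁻¹' e'.source))

/-! ### Submanifolds of a locally convex space -/

section Submanifold

variable {Y : Type w} [AddCommGroup Y] [Module ℝ Y] [TopologicalSpace Y]

/-- A `C^r`-diffeomorphism `φ` between open subsets `φ.source` and `φ.target` of the locally
convex space `Y` that maps `φ.source ∩ N` onto `φ.target ∩ F`. -/
structure IsAdaptedChart (r : ℕ∞) (N : Set Y) (F : Submodule ℝ Y)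
    (φ : OpenPartialHomeomorph Y Y) : Prop where
  contDiffOn : MBContDiffOn r φ φ.source
  contDiffOn_symm : MBContDiffOn r φ.symm φ.target
  image_eq : φ '' (φ.source ∩ N) = φ.target ∩ (F : Set Y)

/-- `N` is a `C^r`-submanifold of the locally convex space `Y`, modelled on the closed vector
subspace `F` of `Y`. -/
structure IsMBSubmanifold (r : ℕ∞) (N : Set Y) (F : Submodule ℝ Y) : Prop where
  isClosed : IsClosed (F : Set Y)
  exists_chart : ∀ p ∈ N, ∃ φ : OpenPartialHomeomorph Y Y, p ∈ φ.source ∧ IsAdaptedChart r N F φ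

variable {r : ℕ∞} {N : Set Y} {F : Submodule ℝ Y} {φ : OpenPartialHomeomorph Y Y}

theorem IsAdaptedChart.map_mem (h : IsAdaptedChart r N F φ) {x : Y} (hx : x ∈ φ.source)
    (hN : x ∈ N) : φ x ∈ F :=
  (h.image_eq.subset ⟨x, ⟨hx, hN⟩, rfl⟩).2

theorem IsAdaptedChart.symm_mem (h : IsAdaptedChart r N F φ) {y : Y} (hy : y ∈ φ.target)
    (hF : y ∈ F) : φ.symm y ∈ N := by
  obtain ⟨x, ⟨hx, hN⟩, rfl⟩ := h.image_eq.superset ⟨hy, hF⟩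
  rwa [φ.left_inv hx]

open Classical in
/-- The restriction `φ.source ∩ N → φ.target ∩ F` of an adapted chart, as a chart of `N` with
values in `F`. The point `p` only serves as the value of the inverse map off `φ.target`. -/
noncomputable def IsAdaptedChart.restrict (h : IsAdaptedChart r N F φ) (p : N) :
    OpenPartialHomeomorph N F where
  toFun x := if hx : (x : Y) ∈ φ.source then ⟨φ x, h.map_mem hx x.2⟩ else 0
  invFun y := if hy : (y : Y) ∈ φ.target then ⟨φ.symm y, h.symm_mem hy y.2⟩ else p
  source := {x | (x : Y) ∈ φ.source}
  target := {y | (y : Y) ∈ φ.target}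
  map_source' x hx := by
    have hx' : (x : Y) ∈ φ.source := hx
    simp [hx', φ.map_source hx']
  map_target' y hy := by
    have hy' : (y : Y) ∈ φ.target := hy
    simp [hy', φ.map_target hy']
  left_inv' x hx := by
    have hx' : (x : Y) ∈ φ.source := hx
    apply Subtype.ext
    simp [hx', φ.map_source hx', φ.left_inv hx']
  right_inv' y hy := by
    have hy' : (y : Y) ∈ φ.target := hy
    apply Subtype.ext
    simp [hy', φ.map_target hy', φ.right_inv hy']
  open_source := φ.open_source.preimage continuous_subtype_val
  open_target := φ.open_target.preimage continuous_subtype_val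
  continuousOn_toFun := by
    rw [Topology.IsInducing.subtypeVal.continuousOn_iff]
    refine (φ.continuousOn.comp continuous_subtype_val.continuousOn fun x hx => hx).congr ?_
    intro x hx
    have hx' : (x : Y) ∈ φ.source := hx
    simp [hx']
  continuousOn_invFun := by
    rw [Topology.IsInducing.subtypeVal.continuousOn_iff]
    refine (φ.continuousOn_symm.comp continuous_subtype_val.continuousOn fun y hy => hy).congr ?_
    intro y hy
    have hy' : (y : Y) ∈ φ.target := hy
    simp [hy']

/-- The natural manifold structure of a submanifold `N` modelled on `F`: its charts are the
restrictions of all the adapted charts. -/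
@[reducible]
noncomputable def IsMBSubmanifold.chartedSpace (h : IsMBSubmanifold r N F) : ChartedSpace F N where
  atlas := {e | ∃ (φ : OpenPartialHomeomorph Y Y) (hφ : IsAdaptedChart r N F φ) (p : N),
    e = hφ.restrict p}
  chartAt p := (h.exists_chart p p.2).choose_spec.2.restrict p
  mem_chart_source p := (h.exists_chart p p.2).choose_spec.1
  chart_mem_atlas p := ⟨_, (h.exists_chart p p.2).choose_spec.2, p, rfl⟩

end Submanifold

/-- A `C^r`-embedding, in the sense of Michal–Bastiani, of a manifold `M` modelled on `E` into the
locally convex space `Y`: a `C^r`-map `f : M → Y` whose image is a submanifold of `Y` and which is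
a `C^r`-diffeomorphism from `M` onto its image (with its natural manifold structure). -/
def IsMBEmbedding (E : Type u) [AddCommGroup E] [Module ℝ E] [TopologicalSpace E]
    {M : Type v} [TopologicalSpace M] [ChartedSpace E M]
    {Y : Type w} [AddCommGroup Y] [Module ℝ Y] [TopologicalSpace Y]
    (r : ℕ∞) (f : M → Y) : Prop :=
  MBContMDiff E Y r f ∧
  ∃ (F : Submodule ℝ Y) (hF : IsMBSubmanifold r (Set.range f) F),
    letI : ChartedSpace F (Set.range f) := hF.chartedSpace
    ∃ g : Set.range f → M,
      Function.LeftInverse g (Set.rangeFactorization f) ∧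
      Function.RightInverse g (Set.rangeFactorization f) ∧
      MBContMDiff E F r (Set.rangeFactorization f) ∧
      MBContMDiff F E r g

/-- The set `C^r_c(M, ℝ)` of compactly supported real-valued `C^r`-functions on `M`. -/
def CompactlySupportedCr (E : Type u) [NormedAddCommGroup E] [NormedSpace ℝ E]
    (M : Type v) [TopologicalSpace M] [ChartedSpace E M] (r : ℕ∞) : Type v :=
  {f : M → ℝ // ContMDiff 𝓘(ℝ, E) 𝓘(ℝ, ℝ) (r : ℕ∞ω) f ∧ HasCompactSupport f}

/-- The evaluation map `x ↦ (f x)_f` from `M` to `ℝ^I` with `I = C^r_c(M, ℝ)`. -/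
def evaluationMap (E : Type u) [NormedAddCommGroup E] [NormedSpace ℝ E]
    (M : Type v) [TopologicalSpace M] [ChartedSpace E M] (r : ℕ∞) :
    M → (CompactlySupportedCr E M r → ℝ) :=
  fun x f => f.1 x

/-! ### Basic properties of Michal–Bastiani differentiability -/

section Calculus

variable {E : Type u} [AddCommGroup E] [Module ℝ E] [TopologicalSpace E]
  {F : Type v} [AddCommGroup F] [Module ℝ F] [TopologicalSpace F]

/-! The image of the evaluation map is locally the graph of a `C^r`-map over finitely many
coordinates, and a shear flattens such a graph.

Near `p`, cut the coordinates of a chart off by a bump function and extend by zero. The resulting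
functions are finitely many indices in `I`, so a continuous linear projection `A` of `ℝ^I` recovers
the chart on a neighbourhood `V`, and evaluation composed with the inverse chart is a `C^r`-section
`c` of `A` over `V`. A second bump function `g` gives the open set `0 < y g`, which excludes all
points of the image coming from elsewhere in `M` (`exists_coordinateFunctions`). With `s` the linear
coordinate section, `y ↦ y - c (A y) + s (A y)` takes the image into a coordinate subspace
(`isAdaptedChart_shearChart`).

This subspace depends on `p`; a permutation of `I` moves it to a fixed one
(`exists_continuousLinearEquiv_coordInclusion`). In such charts evaluation is a linear isomorphism,
hence a diffeomorphism onto its image (`isMBEmbedding_of_adaptedCharts`).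

The calculus needed is small: sums, products of targets, and composition with continuous linear maps
on either side, without a general chain rule. -/

theorem MBContDiffOnNat.continuousOn {k : ℕ} {f : E → F} {U : Set E}
    (h : MBContDiffOnNat k f U) : ContinuousOn f U := by
  cases k with
  | zero => exact h
  | succ k => exact h.1

theorem MBContDiffOnNat.mono {k : ℕ} {E : Type u} [AddCommGroup E] [Module ℝ E]
    [TopologicalSpace E] {f : E → F} {U V : Set E}
    (h : MBContDiffOnNat k f V) (hUV : U ⊆ V) : MBContDiffOnNat k f U := by
  induction k generalizing E with
  | zero => exact ContinuousOn.mono h hUV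
  | succ k ih =>
    obtain ⟨hc, df, hd, hk⟩ := h
    exact ⟨hc.mono hUV, df, fun x hx => hd x (hUV hx), ih hk (Set.prod_mono hUV subset_rfl)⟩

theorem tendsto_add_smul_nhdsNE_zero [ContinuousAdd E] [ContinuousSMul ℝ E] (x y : E) :
    Filter.Tendsto (fun t : ℝ => x + t • y) (𝓝[≠] 0) (𝓝 x) := by
  have h : Continuous fun t : ℝ => x + t • y := by fun_prop
  simpa using (h.tendsto 0).mono_left nhdsWithin_le_nhds

theorem MBContDiffOnNat.congr [ContinuousAdd E] [ContinuousSMul ℝ E] {k : ℕ} {f g : E → F}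
    {U : Set E} (h : MBContDiffOnNat k f U) (hU : IsOpen U) (hfg : Set.EqOn g f U) :
    MBContDiffOnNat k g U := by
  cases k with
  | zero => exact ContinuousOn.congr h hfg
  | succ k =>
    obtain ⟨hc, df, hd, hk⟩ := h
    refine ⟨hc.congr hfg, df, fun x hx y => (hd x hx y).congr' ?_, hk⟩
    filter_upwards [tendsto_add_smul_nhdsNE_zero x y (hU.mem_nhds hx)] with t ht
    rw [hfg hx, hfg ht]

/-- The derivative of `f ∘ A` is `df ∘ (A × A)`, again a composition with a linear map, so the
induction closes once the spaces are allowed to vary. -/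
theorem MBContDiffOnNat.comp_continuousLinearMap {k : ℕ}
    {E : Type u} [AddCommGroup E] [Module ℝ E] [TopologicalSpace E]
    {D : Type w} [AddCommGroup D] [Module ℝ D] [TopologicalSpace D]
    {f : E → F} {U : Set E} (h : MBContDiffOnNat k f U) (A : D →L[ℝ] E) :
    MBContDiffOnNat k (f ∘ A) (A ⁻¹' U) := by
  induction k generalizing E D with
  | zero => exact ContinuousOn.comp h A.continuous.continuousOn (Set.mapsTo_preimage _ _)
  | succ k ih =>
    obtain ⟨hc, df, hd, hk⟩ := h
    refine ⟨hc.comp A.continuous.continuousOn (Set.mapsTo_preimage _ _), df ∘ A.prodMap A,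
      fun x hx y => ?_, ?_⟩
    · simpa using hd (A x) hx (A y)
    · refine (ih hk (A.prodMap A)).mono ?_
      rintro ⟨x, y⟩ ⟨hx, -⟩
      exact ⟨hx, trivial⟩

theorem MBContDiffOnNat.continuousLinearMap_comp {k : ℕ}
    {E : Type u} [AddCommGroup E] [Module ℝ E] [TopologicalSpace E]
    {G : Type w} [AddCommGroup G] [Module ℝ G] [TopologicalSpace G]
    {f : E → F} {U : Set E} (h : MBContDiffOnNat k f U) (A : F →L[ℝ] G) :
    MBContDiffOnNat k (A ∘ f) U := by
  induction k generalizing E with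
  | zero => exact A.continuous.comp_continuousOn h
  | succ k ih =>
    obtain ⟨hc, df, hd, hk⟩ := h
    refine ⟨A.continuous.comp_continuousOn hc, A ∘ df, fun x hx y => ?_, ih hk⟩
    have := (A.continuous.tendsto _).comp (hd x hx y)
    refine this.congr fun t => ?_
    simp

theorem MBContDiffOnNat.add [ContinuousAdd F] {k : ℕ}
    {E : Type u} [AddCommGroup E] [Module ℝ E] [TopologicalSpace E]
    {f g : E → F} {U : Set E} (hf : MBContDiffOnNat k f U) (hg : MBContDiffOnNat k g U) :
    MBContDiffOnNat k (f + g) U := by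
  induction k generalizing E with
  | zero => exact ContinuousOn.add hf hg
  | succ k ih =>
    obtain ⟨hc, df, hd, hk⟩ := hf
    obtain ⟨hc', dg, hd', hk'⟩ := hg
    refine ⟨hc.add hc', df + dg, fun x hx y => ?_, ih hk hk'⟩
    refine ((hd x hx y).add (hd' x hx y)).congr fun t => ?_
    rw [← smul_add]
    congr 1
    simp only [Pi.add_apply]
    abel

theorem ContinuousLinearMap.mbContDiffOnNat {k : ℕ}
    {E : Type u} [AddCommGroup E] [Module ℝ E] [TopologicalSpace E]
    (A : E →L[ℝ] F) (U : Set E) : MBContDiffOnNat k A U := by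
  induction k generalizing E with
  | zero => exact A.continuous.continuousOn
  | succ k ih =>
    refine ⟨A.continuous.continuousOn, A.comp (ContinuousLinearMap.snd ℝ E E),
      fun x _ y => ?_, ih _ _⟩
    refine tendsto_const_nhds.congr' ?_
    filter_upwards [self_mem_nhdsWithin] with t ht
    simp [smul_smul, inv_mul_cancel₀ (show t ≠ 0 from ht)]

/-- Limits and continuity in a product are coordinatewise, so no uniformity in the index is needed,
however large the index set. -/
theorem MBContDiffOnNat.pi {ι : Type w} {k : ℕ}
    {E : Type u} [AddCommGroup E] [Module ℝ E] [TopologicalSpace E]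
    {f : E → ι → F} {U : Set E} (h : ∀ i, MBContDiffOnNat k (fun x => f x i) U) :
    MBContDiffOnNat k f U := by
  induction k generalizing E with
  | zero => exact continuousOn_pi.2 h
  | succ k ih =>
    choose hc df hd hk using h
    exact ⟨continuousOn_pi.2 hc, fun x i => df i x,
      fun x hx y => tendsto_pi_nhds.2 fun i => hd i x hx y, ih hk⟩

theorem ContDiffOn.mbContDiffOnNat {k : ℕ} {E : Type u} [NormedAddCommGroup E] [NormedSpace ℝ E]
    {F : Type v} [NormedAddCommGroup F] [NormedSpace ℝ F]
    {f : E → F} {U : Set E} (h : ContDiffOn ℝ k f U) (hU : IsOpen U) :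
    MBContDiffOnNat k f U := by
  induction k generalizing E with
  | zero => exact h.continuousOn
  | succ k ih =>
    refine ⟨h.continuousOn, fun p => fderiv ℝ f p.1 p.2, fun x hx y => ?_, ih ?_ ?_⟩
    · have hx' : HasFDerivAt f (fderiv ℝ f x) x :=
        ((h.contDiffAt (hU.mem_nhds hx)).differentiableAt (by simp)).hasFDerivAt
      exact (hx'.hasLineDerivAt y).tendsto_slope_zero
    · have hd : ContDiffOn ℝ k (fderiv ℝ f) U := h.fderiv_of_isOpen hU (by simp)
      exact (hd.comp contDiffOn_fst fun p hp => hp.1).clm_apply contDiffOn_snd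
    · exact hU.prod isOpen_univ

end Calculus

/-! ### Embedding criterion and straightening of graphs -/

section Embedding

variable {E : Type u} [NormedAddCommGroup E] [NormedSpace ℝ E]
  {M : Type v} [TopologicalSpace M] [ChartedSpace E M]
  {Y : Type w} [AddCommGroup Y] [Module ℝ Y] [TopologicalSpace Y]
  [IsTopologicalAddGroup Y] [ContinuousSMul ℝ Y] {r : ℕ∞}

/-- A map of class `C^r` is an embedding if, around each point, an adapted chart of its image
turns it into a linear isomorphism in the preferred chart of the source. -/
theorem isMBEmbedding_of_adaptedCharts {f : M → Y} (hf : MBContMDiff E Y r f) {F : Submodule ℝ Y}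
    (hF : IsClosed (F : Set Y))
    (H : ∀ p : M, ∃ (φ : OpenPartialHomeomorph Y Y) (L : E ≃L[ℝ] F),
      f p ∈ φ.source ∧ IsAdaptedChart r (Set.range f) F φ ∧
      ∀ x, f x ∈ φ.source → x ∈ (chartAt E p).source ∧ φ (f x) = L (chartAt E p x)) :
    IsMBEmbedding E r f := by
  choose φ L hp hφ hloc using H
  have hinj : Function.Injective f := by
    intro x p hxp
    obtain ⟨h1, h2⟩ := hloc p x (hxp ▸ hp p)
    obtain ⟨h3, h4⟩ := hloc p p (hp p)
    rw [hxp, h4] at h2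
    exact (chartAt E p).injOn h1 h3 ((L p).injective (Subtype.ext h2.symm))
  have hN : IsMBSubmanifold r (Set.range f) F :=
    ⟨hF, by rintro _ ⟨p, rfl⟩; exact ⟨φ p, hp p, hφ p⟩⟩
  refine ⟨hf, F, hN, ?_⟩
  let _ : ChartedSpace F (Set.range f) := hN.chartedSpace
  have hg : ∀ y : Set.range f, ∃ x, f x = y := fun y => y.2
  choose g hg using hg
  have hgf : ∀ x, g (Set.rangeFactorization f x) = x := fun x => hinj (hg _)
  have hfg : ∀ y, Set.rangeFactorization f (g y) = y := fun y => Subtype.ext (hg y)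
  have hcont : Continuous (Set.rangeFactorization f) := hf.1.subtype_mk _
  have hgcont : Continuous g := by
    rw [continuous_iff_continuousAt]
    intro y
    obtain ⟨p, rfl⟩ : ∃ p, Set.rangeFactorization f p = y := ⟨g y, hfg y⟩
    set e := (hφ p).restrict (Set.rangeFactorization f p) with he
    have hsrc : e.source ∈ 𝓝 (Set.rangeFactorization f p) := e.open_source.mem_nhds (hp p)
    -- The hypothesis covers every `x` with `f x ∈ φ.source`, not only those near `p`; hence `g` is
    -- locally a composite of continuous maps.
    have heq : g =ᶠ[𝓝 (Set.rangeFactorization f p)]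
        fun z => (chartAt E p).symm ((L p).symm (e z)) := by
      filter_upwards [hsrc] with z hz
      have hz' : (z : Y) ∈ (φ p).source := hz
      obtain ⟨h1, h2⟩ := hloc p (g z) (by rwa [hg])
      have h3 : e z = L p (chartAt E p (g z)) := by
        apply Subtype.ext
        rw [← h2, hg]
        simp [he, IsAdaptedChart.restrict, hz']
      rw [h3, ContinuousLinearEquiv.symm_apply_apply, (chartAt E p).left_inv h1]
    refine ContinuousAt.congr ?_ heq.symm
    have h3 : e (Set.rangeFactorization f p) = L p (chartAt E p p) := by
      apply Subtype.ext
      rw [← (hloc p p (hp p)).2]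
      have := hp p
      simp [he, IsAdaptedChart.restrict, this]
    have c1 : ContinuousAt (fun z => (L p).symm (e z)) (Set.rangeFactorization f p) :=
      (L p).symm.continuous.continuousAt.comp (e.continuousAt (hp p))
    refine ContinuousAt.comp ?_ c1
    rw [h3, ContinuousLinearEquiv.symm_apply_apply]
    exact (chartAt E p).continuousAt_symm ((chartAt E p).map_source (mem_chart_source E p))
  refine ⟨g, hgf, hfg, ⟨hcont, fun p => ?_⟩, ⟨hgcont, fun y => ?_⟩⟩
  · refine ⟨chartAt E p, chart_mem_atlas E p, (hφ p).restrict (Set.rangeFactorization f p),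
      ⟨φ p, hφ p, _, rfl⟩, mem_chart_source E p, hp p, fun k hk => ?_⟩
    refine MBContDiffOnNat.congr ((L p : E →L[ℝ] F).mbContDiffOnNat _) ?_ ?_
    · exact (chartAt E p).continuousOn_symm.isOpen_inter_preimage (chartAt E p).open_target
        (((hφ p).restrict _).open_source.preimage hcont)
    · rintro u ⟨hu, hu'⟩
      have hu' : f ((chartAt E p).symm u) ∈ (φ p).source := hu'
      apply Subtype.ext
      have h2 := (hloc p _ hu').2
      rw [(chartAt E p).right_inv hu] at h2
      simp [IsAdaptedChart.restrict, hu', h2]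
  · obtain ⟨p, rfl⟩ : ∃ p, Set.rangeFactorization f p = y := ⟨g y, hfg y⟩
    refine ⟨(hφ p).restrict (Set.rangeFactorization f p), ⟨φ p, hφ p, _, rfl⟩,
      chartAt E p, chart_mem_atlas E p, hp p, ?_, fun k hk => ?_⟩
    · rw [hgf]; exact mem_chart_source E p
    refine MBContDiffOnNat.congr (((L p).symm : F →L[ℝ] E).mbContDiffOnNat _) ?_ ?_
    · exact ((hφ p).restrict _).continuousOn_symm.isOpen_inter_preimage
        ((hφ p).restrict _).open_target ((chartAt E p).open_source.preimage hgcont)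
    · rintro z ⟨hz, -⟩
      have hz' : (z : Y) ∈ (φ p).target := hz
      set y := ((hφ p).restrict (Set.rangeFactorization f p)).symm z with hy
      have hyz : (y : Y) = (φ p).symm z := by
        exact congrArg Subtype.val (dif_pos hz')
      have hys : f (g y) ∈ (φ p).source := by
        rw [hg, hyz]; exact (φ p).map_target hz'
      have h2 := (hloc p _ hys).2
      rw [hg, hyz, (φ p).right_inv hz'] at h2
      change chartAt E p (g y) = (L p).symm z
      rw [ContinuousLinearEquiv.eq_symm_apply]
      exact Subtype.ext h2.symm

omit [ContinuousSMul ℝ Y] in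
theorem continuousOn_shear_inverse (A : Y →L[ℝ] E) (s : E →L[ℝ] Y) (T : Y ≃L[ℝ] Y)
    {V : Set E} {c : E → Y} (hc : ContinuousOn c V) :
    ContinuousOn (fun z => T.symm z + (c (A (T.symm z)) - s (A (T.symm z))))
      ((A ∘L (T.symm : Y →L[ℝ] Y)) ⁻¹' V) :=
  (T.symm.continuous.continuousOn).add <|
    (hc.comp (A ∘L (T.symm : Y →L[ℝ] Y)).continuous.continuousOn fun _ hz => hz).sub
      ((s ∘L A) ∘L (T.symm : Y →L[ℝ] Y)).continuous.continuousOn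

/-- The shear `y ↦ T (y - c (A y) + s (A y))`, which takes the graph `c` over `A` to the linear
section `s`, followed by the linear automorphism `T`. -/
noncomputable def shearChart (A : Y →L[ℝ] E) (s : E →L[ℝ] Y) (T : Y ≃L[ℝ] Y) (hs : ∀ u, A (s u) = u)
    {V : Set E} (hV : IsOpen V) {c : E → Y} (hc : ContinuousOn c V) (hAc : ∀ u ∈ V, A (c u) = u)
    {O : Set Y} (hO : IsOpen O) : OpenPartialHomeomorph Y Y where
  -- Apart from `T`, both maps translate within the fibres of `A` over `V`, because `s` and `c` are
  -- sections there; the translations are opposite.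
  toFun y := T (y + (s (A y) - c (A y)))
  invFun z := T.symm z + (c (A (T.symm z)) - s (A (T.symm z)))
  source := A ⁻¹' V ∩ O
  target := ((A ∘L (T.symm : Y →L[ℝ] Y)) ⁻¹' V) ∩
    (fun z => T.symm z + (c (A (T.symm z)) - s (A (T.symm z)))) ⁻¹' O
  map_source' y hy := by
    have h1 : A y ∈ V := hy.1
    have h2 : y + (s (A y) - c (A y)) + (c (A y) - s (A y)) = y := by abel
    simpa [hs, hAc _ h1, h2] using hy
  map_target' z hz := by
    have h1 : A (T.symm z) ∈ V := hz.1
    refine ⟨?_, hz.2⟩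
    simpa [hs, hAc _ h1] using h1
  left_inv' y hy := by
    have h1 : A y ∈ V := hy.1
    simp only [ContinuousLinearEquiv.symm_apply_apply, map_add, map_sub, hs, hAc _ h1, sub_self,
      add_zero]
    abel
  right_inv' z hz := by
    have h1 : A (T.symm z) ∈ V := hz.1
    rw [← T.eq_symm_apply]
    simp only [map_add, map_sub, hs, hAc _ h1, sub_self, add_zero]
    abel
  open_source := (hV.preimage A.continuous).inter hO
  open_target :=
    ContinuousOn.isOpen_inter_preimage (continuousOn_shear_inverse A s T hc)
      (hV.preimage (A ∘L (T.symm : Y →L[ℝ] Y)).continuous) hO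
  continuousOn_toFun :=
    T.continuous.comp_continuousOn <| continuousOn_id.add <|
      (s.comp A).continuous.continuousOn.sub <|
        hc.comp A.continuous.continuousOn fun _ hy => hy.1
  continuousOn_invFun := (continuousOn_shear_inverse A s T hc).mono Set.inter_subset_left

/-- A point of `N` in the source equals `c (A y)`, so it is sent to `T (s (A y)) = s₀ (A y)`;
conversely `s₀ u` in the target comes from `c u ∈ N`. Only `c` is nonlinear in the shear and its
inverse. -/
theorem isAdaptedChart_shearChart (A : Y →L[ℝ] E) (s : E →L[ℝ] Y) (T : Y ≃L[ℝ] Y)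
    (hs : ∀ u, A (s u) = u) {V : Set E} (hV : IsOpen V) {c : E → Y} (hc : ContinuousOn c V)
    (hAc : ∀ u ∈ V, A (c u) = u) {O : Set Y} (hO : IsOpen O) (hcr : MBContDiffOn r c V)
    {N : Set Y} (hcN : ∀ u ∈ V, c u ∈ N) (hN : ∀ y ∈ N, A y ∈ V → y ∈ O → y = c (A y))
    {s₀ : E →L[ℝ] Y} (hT : ∀ u, T (s u) = s₀ u) :
    IsAdaptedChart r N (LinearMap.range (s₀ : E →ₗ[ℝ] Y)) (shearChart A s T hs hV hc hAc hO) where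
  contDiffOn k hk := by
    have h1 := ((hcr k hk).comp_continuousLinearMap A).continuousLinearMap_comp
      (-ContinuousLinearMap.id ℝ Y)
    have h2 := (((ContinuousLinearMap.id ℝ Y + s.comp A).mbContDiffOnNat (A ⁻¹' V)).add
      h1).continuousLinearMap_comp (T : Y →L[ℝ] Y)
    have h3 := h2.mono (U := (shearChart A s T hs hV hc hAc hO).source) fun y hy => hy.1
    refine h3.congr (shearChart A s T hs hV hc hAc hO).open_source fun y _ => ?_
    simp [shearChart, sub_eq_add_neg, add_assoc]
  contDiffOn_symm k hk := by
    have h1 := (hcr k hk).comp_continuousLinearMap A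
    have h2 := (((ContinuousLinearMap.id ℝ Y - s.comp A).mbContDiffOnNat (A ⁻¹' V)).add
      h1).comp_continuousLinearMap (T.symm : Y →L[ℝ] Y)
    have h3 := h2.mono (U := (shearChart A s T hs hV hc hAc hO).target) fun y hy => hy.1
    refine h3.congr (shearChart A s T hs hV hc hAc hO).open_target fun y _ => ?_
    change T.symm y + (c (A (T.symm y)) - s (A (T.symm y))) =
      (T.symm y - s (A (T.symm y))) + c (A (T.symm y))
    abel
  image_eq := by
    ext z
    constructor
    · rintro ⟨y, ⟨hy, hyN⟩, rfl⟩
      refine ⟨(shearChart A s T hs hV hc hAc hO).map_source hy, A y, ?_⟩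
      have h := hN y hyN hy.1 hy.2
      change s₀ (A y) = T (y + (s (A y) - c (A y)))
      rw [← h, ← hT]
      simp
    · rintro ⟨hz, u, rfl⟩
      refine ⟨_, ⟨(shearChart A s T hs hV hc hAc hO).map_target hz, ?_⟩,
        (shearChart A s T hs hV hc hAc hO).right_inv hz⟩
      have hTs : T.symm (s₀ u) = s u := by rw [← hT]; simp
      have hu : u ∈ V := by
        have h1 : A (T.symm (s₀ u)) ∈ V := hz.1
        rwa [hTs, hs] at h1
      change T.symm (s₀ u) + (c (A (T.symm (s₀ u))) - s (A (T.symm (s₀ u)))) ∈ N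
      rw [hTs, hs]
      simpa using hcN u hu

/-- The isomorphism of `E` onto the range of a continuous linear section. -/
noncomputable def ContinuousLinearEquiv.rangeOfSection (A : Y →L[ℝ] E) (s : E →L[ℝ] Y)
    (hs : ∀ u, A (s u) = u) : E ≃L[ℝ] LinearMap.range (s : E →ₗ[ℝ] Y) :=
  ContinuousLinearEquiv.equivOfInverse
    (s.codRestrict _ fun u => ⟨u, rfl⟩) (A.comp (Submodule.subtypeL _)) hs
    (by rintro ⟨_, u, rfl⟩; exact Subtype.ext (congrArg s (hs u)))

end Embedding

/-! ### Coordinate subspaces of `ℝ^I` -/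

section Coordinates

variable {E : Type u} [NormedAddCommGroup E] [NormedSpace ℝ E] [FiniteDimensional ℝ E]
  {J : Type*} [Fintype J] (b : Module.Basis J ℝ E) {I : Type v}

/-- The projection of `ℝ^I` to `E` that reads the coordinate of `b j` off the index `i j`. -/
noncomputable def coordProjection (i : J → I) : (I → ℝ) →L[ℝ] E :=
  ∑ j, (ContinuousLinearMap.proj (i j) : (I → ℝ) →L[ℝ] ℝ).smulRight (b j)

open Classical in
/-- The inclusion of `E` in `ℝ^I` that puts the coordinate of `b j` at the index `i j`. -/
noncomputable def coordInclusion (i : J → I) : E →L[ℝ] (I → ℝ) :=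
  ContinuousLinearMap.pi fun k =>
    ∑ j, if k = i j then LinearMap.toContinuousLinearMap (b.coord j) else 0

omit [FiniteDimensional ℝ E] in
theorem coordProjection_eq {i : J → I} {y : I → ℝ} {u : E} (h : ∀ j, y (i j) = b.coord j u) :
    coordProjection b i y = u := by
  simp [coordProjection, h, b.sum_repr]

open Classical in
theorem coordInclusion_apply (i : J → I) (u : E) (k : I) :
    coordInclusion b i u k = ∑ j, if k = i j then b.coord j u else 0 := by
  simp only [coordInclusion, ContinuousLinearMap.coe_pi', _root_.sum_apply]
  refine Finset.sum_congr rfl fun j _ => ?_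
  split_ifs <;> simp

theorem coordProjection_coordInclusion {i : J → I} (hi : Function.Injective i) (u : E) :
    coordProjection b i (coordInclusion b i u) = u := by
  classical
  refine coordProjection_eq b fun j => ?_
  simp [coordInclusion_apply, hi.eq_iff]

/-- As `J` is finite, some permutation of `I` carries `i` to `i₀`; let it permute the coordinates.
-/
theorem exists_continuousLinearEquiv_coordInclusion {i i₀ : J → I} (hi : Function.Injective i)
    (hi₀ : Function.Injective i₀) :
    ∃ T : (I → ℝ) ≃L[ℝ] (I → ℝ), ∀ u, T (coordInclusion b i u) = coordInclusion b i₀ u := by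
  classical
  obtain ⟨σ, hσ⟩ := Equiv.Perm.exists_extending_pair i i₀ hi hi₀
  refine ⟨ContinuousLinearEquiv.piCongrLeft ℝ (fun _ => ℝ) σ, fun u => ?_⟩
  ext k
  obtain ⟨k, rfl⟩ := σ.surjective k
  have h : ContinuousLinearEquiv.piCongrLeft ℝ (fun _ => ℝ) σ (coordInclusion b i u) (σ k) =
      coordInclusion b i u k := Equiv.piCongrLeft_apply_apply (fun _ => ℝ) σ _ k
  rw [h, coordInclusion_apply, coordInclusion_apply]
  simp [← hσ, σ.injective.eq_iff]

end Coordinates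

/-! ### Compactly supported functions on a manifold -/

section Functions

variable {E : Type u} [NormedAddCommGroup E] [NormedSpace ℝ E]
  {M : Type v} [TopologicalSpace M] [T2Space M] [ChartedSpace E M] {r : ℕ∞}
  [IsManifold 𝓘(ℝ, E) (r : ℕ∞ω) M]

/-- Extension by zero of a function compactly supported in the target of a chart. -/
noncomputable def extendChart (p : M) (h : E → ℝ) : M → ℝ :=
  (chartAt E p).source.indicator (h ∘ chartAt E p)

omit [NormedSpace ℝ E] [T2Space M] in
theorem extendChart_of_mem {p x : M} (h : E → ℝ) (hx : x ∈ (chartAt E p).source) :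
    extendChart p h x = h (chartAt E p x) :=
  Set.indicator_of_mem hx _

omit [NormedSpace ℝ E] [T2Space M] in
theorem extendChart_of_notMem {p x : M} (h : E → ℝ) (hx : x ∉ (chartAt E p).source) :
    extendChart p h x = 0 :=
  Set.indicator_of_notMem hx _

omit [NormedSpace ℝ E] [T2Space M] in
theorem extendChart_eq_zero {p x : M} {h : E → ℝ}
    (hx : x ∉ (chartAt E p).symm '' tsupport h) : extendChart p h x = 0 := by
  by_cases hxs : x ∈ (chartAt E p).source
  · rw [extendChart_of_mem h hxs]
    by_contra hne
    exact hx ⟨_, subset_tsupport h hne, (chartAt E p).left_inv hxs⟩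
  · exact extendChart_of_notMem h hxs

omit [NormedSpace ℝ E] [T2Space M] in
theorem isCompact_image_tsupport {p : M} {h : E → ℝ} (hc : HasCompactSupport h)
    (hs : tsupport h ⊆ (chartAt E p).target) :
    IsCompact ((chartAt E p).symm '' tsupport h) :=
  hc.isCompact.image_of_continuousOn ((chartAt E p).continuousOn_symm.mono hs)

omit [NormedSpace ℝ E] in
theorem hasCompactSupport_extendChart {p : M} {h : E → ℝ} (hc : HasCompactSupport h)
    (hs : tsupport h ⊆ (chartAt E p).target) : HasCompactSupport (extendChart p h) :=
  HasCompactSupport.intro (isCompact_image_tsupport hc hs) fun _ => extendChart_eq_zero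

theorem contMDiff_extendChart {p : M} {h : E → ℝ} (hr : ContDiff ℝ (r : ℕ∞ω) h)
    (hc : HasCompactSupport h) (hs : tsupport h ⊆ (chartAt E p).target) :
    ContMDiff 𝓘(ℝ, E) 𝓘(ℝ, ℝ) (r : ℕ∞ω) (extendChart p h) := by
  intro x
  by_cases hx : x ∈ (chartAt E p).source
  · have h1 : ContMDiffAt 𝓘(ℝ, E) 𝓘(ℝ, ℝ) (r : ℕ∞ω) (h ∘ chartAt E p) x :=
      hr.contMDiff.contMDiffAt.comp x
        (contMDiffOn_chart.contMDiffAt ((chartAt E p).open_source.mem_nhds hx))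
    refine h1.congr_of_eventuallyEq ?_
    filter_upwards [(chartAt E p).open_source.mem_nhds hx] with y hy
    exact extendChart_of_mem h hy
  · have hxK : x ∉ (chartAt E p).symm '' tsupport h := by
      rintro ⟨u, hu, rfl⟩
      exact hx ((chartAt E p).map_target (hs hu))
    refine (contMDiffAt_const (c := (0 : ℝ))).congr_of_eventuallyEq ?_
    -- The Hausdorff property makes the compact image of the support closed, so the extension
    -- vanishes near `x`.
    filter_upwards [(isCompact_image_tsupport hc hs).isClosed.isOpen_compl.mem_nhds hxK] with y hy
    exact extendChart_eq_zero hy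

/-- Extension by zero, as an element of `C^r_c(M, ℝ)`. -/
noncomputable def CompactlySupportedCr.extend (p : M) (h : E → ℝ) (hr : ContDiff ℝ (r : ℕ∞ω) h)
    (hc : HasCompactSupport h) (hs : tsupport h ⊆ (chartAt E p).target) :
    CompactlySupportedCr E M r :=
  ⟨extendChart p h, contMDiff_extendChart hr hc hs, hasCompactSupport_extendChart hc hs⟩

/-- Around each point of a manifold, finitely many compactly supported functions restrict to the
coordinates of a chart, and another one singles out the neighbourhood where they do. -/
theorem exists_coordinateFunctions [FiniteDimensional ℝ E] {J : Type*} (b : Module.Basis J ℝ E)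
    (p : M) :
    ∃ (i : J → CompactlySupportedCr E M r) (g : CompactlySupportedCr E M r) (V : Set E),
      Function.Injective i ∧ IsOpen V ∧ V ⊆ (chartAt E p).target ∧ 0 < g.1 p ∧
      (∀ u ∈ V, ∀ j, (i j).1 ((chartAt E p).symm u) = b.coord j u) ∧
      ∀ x, 0 < g.1 x → x ∈ (chartAt E p).source ∧ chartAt E p x ∈ V := by
  set e := chartAt E p
  have hp : p ∈ e.source := mem_chart_source E p
  obtain ⟨ε, hε, hball⟩ := Metric.isOpen_iff.1 e.open_target _ (e.map_source hp)
  -- The ball of radius `ε / 3` is both a set where `β = 1` and exactly where `γ > 0`.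
  let β : ContDiffBump (e p) := ⟨ε / 3, ε / 2, by positivity, by linarith⟩
  let γ : ContDiffBump (e p) := ⟨ε / 4, ε / 3, by positivity, by linarith⟩
  have hβ : tsupport β ⊆ e.target := by
    rw [β.tsupport_eq]
    exact (Metric.closedBall_subset_ball (by change ε / 2 < ε; linarith)).trans hball
  have hγ : tsupport γ ⊆ e.target := by
    rw [γ.tsupport_eq]
    exact (Metric.closedBall_subset_ball (by change ε / 3 < ε; linarith)).trans hball
  have hV : Metric.ball (e p) (ε / 3) ⊆ e.target :=
    (Metric.ball_subset_ball (by linarith)).trans hball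
  let i : J → CompactlySupportedCr E M r := fun j =>
    .extend p (fun u => β u * b.coord j u)
      (β.contDiff.mul (LinearMap.toContinuousLinearMap (b.coord j)).contDiff)
      β.hasCompactSupport.mul_right ((tsupport_mul_subset_left).trans hβ)
  let g : CompactlySupportedCr E M r := .extend p γ γ.contDiff γ.hasCompactSupport hγ
  have hi : ∀ u ∈ Metric.ball (e p) (ε / 3), ∀ j, (i j).1 (e.symm u) = b.coord j u := by
    intro u hu j
    change extendChart p _ (e.symm u) = _
    rw [extendChart_of_mem _ (e.map_target (hV hu)), e.right_inv (hV hu),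
      β.one_of_mem_closedBall (Metric.ball_subset_closedBall hu), one_mul]
  refine ⟨i, g, Metric.ball (e p) (ε / 3), ?_, Metric.isOpen_ball, hV, ?_, hi, ?_⟩
  · intro j k hjk
    have hcoord : Set.EqOn (b.coord j) (b.coord k) (Metric.ball (e p) (ε / 3)) := fun u hu => by
      rw [← hi u hu, ← hi u hu, hjk]
    by_contra hne
    -- Equal indices would give coordinates agreeing on the ball; a small move from its centre along
    -- `b j` changes only the `j`-th.
    obtain ⟨t, ht, ht0⟩ : ∃ t : ℝ, e p + t • b j ∈ Metric.ball (e p) (ε / 3) ∧ t ≠ 0 :=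
      (((tendsto_add_smul_nhdsNE_zero (e p) (b j)).eventually
        (Metric.ball_mem_nhds _ (by positivity))).and self_mem_nhdsWithin).exists
    have h0 := hcoord (Metric.mem_ball_self (by positivity))
    have h1 := hcoord ht
    have hne' : j ≠ k := hne
    simp only [map_add, map_smul, h0, add_right_inj, smul_eq_mul] at h1
    have := mul_left_cancel₀ ht0 h1
    simp [hne'.symm] at this
  · change 0 < extendChart p γ p
    rw [extendChart_of_mem _ hp]
    exact γ.pos_of_mem_ball (Metric.mem_ball_self γ.rOut_pos)
  · intro x hx
    have hx' : 0 < extendChart p γ x := hx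
    have hxs : x ∈ e.source := by
      by_contra h
      rw [extendChart_of_notMem _ h] at hx'
      exact lt_irrefl _ hx'
    refine ⟨hxs, ?_⟩
    rw [extendChart_of_mem _ hxs] at hx'
    have : e x ∈ Function.support γ := hx'.ne'
    rwa [γ.support_eq] at this

/-! ### The evaluation map -/

omit [T2Space M] in
theorem mbContDiffOn_evaluationMap_comp_chart_symm (p : M) :
    MBContDiffOn r (evaluationMap E M r ∘ (chartAt E p).symm) (chartAt E p).target := by
  intro k hk
  refine MBContDiffOnNat.pi fun f => ?_
  have h : ContMDiffOn 𝓘(ℝ, E) 𝓘(ℝ, ℝ) (r : ℕ∞ω) (f.1 ∘ (chartAt E p).symm)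
      (chartAt E p).target := f.2.1.comp_contMDiffOn contMDiffOn_chart_symm
  exact (h.contDiffOn.of_le (by exact_mod_cast hk)).mbContDiffOnNat (chartAt E p).open_target

omit [T2Space M] [IsManifold 𝓘(ℝ, E) (r : ℕ∞ω) M] in
theorem continuous_evaluationMap : Continuous (evaluationMap E M r) :=
  continuous_pi fun f => f.2.1.continuous

omit [T2Space M] in
theorem mbContMDiff_evaluationMap :
    MBContMDiff E (CompactlySupportedCr E M r → ℝ) r (evaluationMap E M r) := by
  refine ⟨continuous_evaluationMap, fun p => ⟨chartAt E p, chart_mem_atlas E p,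
    OpenPartialHomeomorph.refl _, rfl, mem_chart_source E p, trivial, fun k hk => ?_⟩⟩
  exact (mbContDiffOn_evaluationMap_comp_chart_symm p k hk).mono Set.inter_subset_left

theorem isMBEmbedding_evaluationMap [FiniteDimensional ℝ E] :
    IsMBEmbedding E r (evaluationMap E M r) := by
  rcases isEmpty_or_nonempty M with hM | ⟨⟨p₀⟩⟩
  · exact isMBEmbedding_of_adaptedCharts mbContMDiff_evaluationMap
      (F := ⊤) isClosed_univ fun p => isEmptyElim p
  let b := Module.finBasis ℝ E
  -- The indices at one reference point fix the model subspace for all `p`.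
  obtain ⟨i₀, -, -, hi₀, -⟩ := exists_coordinateFunctions (r := r) b p₀
  have hs₀ := coordProjection_coordInclusion b hi₀
  refine isMBEmbedding_of_adaptedCharts mbContMDiff_evaluationMap
    (F := LinearMap.range (coordInclusion b i₀ : E →ₗ[ℝ] _))
    (Submodule.closed_of_finiteDimensional _) fun p => ?_
  obtain ⟨i, g, V, hi, hV, hVe, hgp, hiV, hg⟩ := exists_coordinateFunctions (r := r) b p
  obtain ⟨T, hT⟩ := exists_continuousLinearEquiv_coordInclusion b hi hi₀
  have hs := coordProjection_coordInclusion b hi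
  have hcr : MBContDiffOn r (evaluationMap E M r ∘ (chartAt E p).symm) V :=
    fun k hk => (mbContDiffOn_evaluationMap_comp_chart_symm p k hk).mono hVe
  have hAc : ∀ u ∈ V,
      coordProjection b i ((evaluationMap E M r ∘ (chartAt E p).symm) u) = u :=
    fun u hu => coordProjection_eq b (hiV u hu)
  have hO : IsOpen {y : CompactlySupportedCr E M r → ℝ | 0 < y g} :=
    isOpen_lt continuous_const (continuous_apply g)
  have hA : ∀ x, 0 < g.1 x →
      coordProjection b i (evaluationMap E M r x) = chartAt E p x := by
    intro x hx
    have h := hAc _ (hg x hx).2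
    rwa [Function.comp_apply, (chartAt E p).left_inv (hg x hx).1] at h
  have hN : ∀ y ∈ Set.range (evaluationMap E M r), 0 < y g →
      y = (evaluationMap E M r ∘ (chartAt E p).symm) (coordProjection b i y) := by
    rintro _ ⟨x, rfl⟩ hx
    rw [hA x hx, Function.comp_apply, (chartAt E p).left_inv (hg x hx).1]
  refine ⟨shearChart (coordProjection b i) (coordInclusion b i) T hs hV
    (hcr 0 (by simp)).continuousOn hAc hO, .rangeOfSection _ _ hs₀, ⟨?_, hgp⟩,
    isAdaptedChart_shearChart (N := Set.range (evaluationMap E M r)) _ _ T hs hV _ hAc hO hcr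
      (fun u _ => ⟨(chartAt E p).symm u, rfl⟩)
      (fun y hy _ hyO => hN y hy hyO) hT, fun x hx => ⟨(hg x hx.2).1, ?_⟩⟩
  · change coordProjection b i (evaluationMap E M r p) ∈ V
    rw [hA p hgp]
    exact (hg p hgp).2
  · have h := hN _ ⟨x, rfl⟩ hx.2
    change T (evaluationMap E M r x + (coordInclusion b i (coordProjection b i _) -
      (evaluationMap E M r ∘ (chartAt E p).symm) (coordProjection b i _))) =
      coordInclusion b i₀ (chartAt E p x)
    rw [← h, add_sub_cancel, hA x hx.2, hT]

end Functions

theorem theoremA (r : ℕ∞) (hr : 1 ≤ r)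
    (E : Type u) [NormedAddCommGroup E] [NormedSpace ℝ E] [FiniteDimensional ℝ E]
    (M : Type v) [TopologicalSpace M] [T2Space M] [ChartedSpace E M]
    [IsManifold 𝓘(ℝ, E) (r : ℕ∞ω) M] :
    (∃ (I : Type v) (Φ : M → (I → ℝ)), IsMBEmbedding E r Φ) ∧
      IsMBEmbedding E r (evaluationMap E M r) :=
  ⟨⟨_, _, isMBEmbedding_evaluationMap⟩, isMBEmbedding_evaluationMap⟩
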